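/- Let $n,d\ge 1$ be integers, let $k=\binom{n+d}{n}-1$, and let $\alpha_0,\dots,\alpha_k$ be the exponents $\alpha\in\mathbb{N}_0^{n+1}$ with $|\alpha|=d$, listed in decreasing lexicographic order (so $\alpha_0=(d,0,\dots,0)$). Write $m_j(x)=x^{\alpha_j}$. For $i=0,\dots,k-n$ let $V_i\subseteq\mathbb{P}^k=\mathbb{P}^k(\mathbb{C})$ be the Zariski closure of $$H_i=\{[z]\in\mathbb{P}^k \mid \exists\,x\in\mathbb{C}^{n+1}\colon (z_0,\dots,z_{n+i})=(m_0(x),\dots,m_{n+i}(x))\}.$$ For $i=1,\dots,k-n$ let $s_i$ be the least $s\in\{1,\dots,k\}$ for which there is $t\in\{s,\dots,k\}$ with $\alpha_s+\alpha_t=\alpha_0+\alpha_{n+i}$, let $t_i\in\{s_i,\dots,k\}$ satisfy $\alpha_{s_i}+\alpha_{t_i}=\alpha_0+\alpha_{n+i}$, and put $q_i(Z)=Z_0Z_{n+i}-Z_{s_i}Z_{t_i}$. For $i=0,\dots,k-n$ let $$K_i=\{(z_1,\dots,z_k)\in\mathbb{C}^k \mid q_j(1,z_1,\dots,z_k)=0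 \text{ for } j=1,\dots,i\},$$ and let $W_i\subseteq\mathbb{P}^k$ be the Zariski closure of the image of $K_i$ under $(z_1,\dots,z_k)\mapsto[1:z_1:\dots:z_k]$. Then such indices $s_i,t_i$ exist for all $i=1,\dots,k-n$, and, for any such choice, $V_i=W_i$ for every $i=0,\dots,k-n$. In particular, $V_i$ is irreducible of codimension $i$ in $\mathbb{P}^k$. -/

import Mathlib

open MvPolynomial
open scoped LinearAlgebra.Projectivization

noncomputable section

/-- Complex projective space `ℙ^k`, that is, the lines through the origin of `ℂ^(k+1)`. -/
def ProjSpace (k : ℕ) : Type := ℙ ℂ (Fin (k + 1) → ℂ)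

/-- The point `[z]` of projective space with homogeneous coordinates `z ≠ 0`. -/
def ProjSpace.mk {k : ℕ} (z : Fin (k + 1) → ℂ) (hz : z ≠ 0) : ProjSpace k :=
  Projectivization.mk ℂ z hz

/-- Homogeneous coordinates of a point of projective space. -/
def ProjSpace.rep {k : ℕ} (p : ProjSpace k) : Fin (k + 1) → ℂ :=
  Projectivization.rep (K := ℂ) (V := Fin (k + 1) → ℂ) p

/-- The set of common zeros in `ℙ^k` of the members of `S`. It is used for sets `S` of forms only,
and for these it does not depend on the choice of the homogeneous coordinates
(see `ProjSpace.eval_rep_mk_eq_zero_iff`). -/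
def projZeroLocus {k : ℕ} (S : Set (MvPolynomial (Fin (k + 1)) ℂ)) : Set (ProjSpace k) :=
  {p | ∀ f ∈ S, eval p.rep f = 0}

/-- A polynomial is a form if it is homogeneous of some degree. -/
def IsForm {k : ℕ} (f : MvPolynomial (Fin (k + 1)) ℂ) : Prop := ∃ e : ℕ, f.IsHomogeneous e

theorem ProjSpace.rep_ne_zero {k : ℕ} (p : ProjSpace k) : p.rep ≠ 0 :=
  Projectivization.rep_nonzero (K := ℂ) (V := Fin (k + 1) → ℂ) p

theorem ProjSpace.eval_rep_mk_eq_zero_iff {k : ℕ} {f : MvPolynomial (Fin (k + 1)) ℂ}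
    (hf : IsForm f) (z : Fin (k + 1) → ℂ) (hz : z ≠ 0) :
    eval (ProjSpace.mk z hz).rep f = 0 ↔ eval z f = 0 := by
  obtain ⟨e, he⟩ := hf
  obtain ⟨a, ha⟩ := Projectivization.exists_smul_eq_mk_rep ℂ z hz
  have h1 : (ProjSpace.mk z hz).rep = fun j => (a : ℂ) * z j := by
    funext j
    exact (congrFun ha j).symm
  have h2 : eval (fun j => (a : ℂ) * z j) f = (a : ℂ) ^ e * eval z f := by
    rw [eval_eq', eval_eq', Finset.mul_sum]
    refine Finset.sum_congr rfl fun b hb => ?_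
    have hb' : ∑ j, b j = e := by
      have := he (mem_support_iff.mp hb)
      rw [Finsupp.weight_apply, Finsupp.sum_fintype _ _ (by simp)] at this
      simpa using this
    rw [← hb', ← Finset.prod_pow_eq_pow_sum]
    simp only [mul_pow, Finset.prod_mul_distrib]
    ring
  rw [h1, h2]
  simp

/-- The Zariski topology on projective space: the closed sets are the sets of common zeros of
sets of forms. -/
instance ProjSpace.zariskiTopology (k : ℕ) : TopologicalSpace (ProjSpace k) :=
  TopologicalSpace.ofClosed {Y | ∃ S : Set (MvPolynomial (Fin (k + 1)) ℂ),
      (∀ f ∈ S, IsForm f) ∧ Y = projZeroLocus S}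
    (by
      refine ⟨{1}, ?_, ?_⟩
      · rintro f rfl
        exact ⟨0, isHomogeneous_one _ _⟩
      · ext p
        simp [projZeroLocus])
    (by
      intro A hA
      refine ⟨{f | IsForm f ∧ ∃ Y ∈ A, ∀ p ∈ Y, eval p.rep f = 0}, fun f hf => hf.1, ?_⟩
      ext p
      constructor
      · rintro hp f ⟨-, Y, hY, h⟩
        exact h p (hp Y hY)
      · intro hp Y hY
        obtain ⟨S, hS, rfl⟩ := hA hY
        intro f hf
        exact hp f ⟨hS f hf, _, hY, fun q hq => hq f hf⟩)
    (by
      rintro _ ⟨S, hS, rfl⟩ _ ⟨T, hT, rfl⟩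
      refine ⟨{h | ∃ f ∈ S, ∃ g ∈ T, h = f * g}, ?_, ?_⟩
      · rintro _ ⟨f, hf, g, hg, rfl⟩
        obtain ⟨a, ha⟩ := hS f hf
        obtain ⟨b, hb⟩ := hT g hg
        exact ⟨a + b, ha.mul hb⟩
      · ext p
        constructor
        · rintro (hp | hp) _ ⟨f, hf, g, hg, rfl⟩
          · simp [hp f hf]
          · simp [hp g hg]
        · intro hp
          by_contra hcon
          simp only [Set.mem_union, not_or, projZeroLocus, Set.mem_ofPred_eq, not_forall] at hcon
          obtain ⟨⟨f, hf, hf0⟩, ⟨g, hg, hg0⟩⟩ := hcon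
          have := hp _ ⟨f, hf, g, hg, rfl⟩
          rw [map_mul, mul_eq_zero] at this
          exact this.elim hf0 hg0)

/-- The codimension of an irreducible closed subset `Y` of a topological space: the supremum of
the lengths `c` of chains `Y = Y₀ ⊊ Y₁ ⊊ ... ⊊ Y_c` of irreducible closed subsets. -/
def irredCodim {T : Type*} [TopologicalSpace T] (Y : Set T) (hY : IsIrreducible Y)
    (hY' : IsClosed Y) : ℕ∞ :=
  Order.coheight (⟨Y, hY, hY'⟩ : TopologicalSpace.IrreducibleCloseds T)

namespace Veronese

/-- `k(n,d) = binom(n+d, n) - 1`; there are `k(n,d) + 1` monomials of degree `d` in `n + 1`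
variables. -/
def k (n d : ℕ) : ℕ := (n + d).choose n - 1

/-- The exponents `a ∈ ℕ^(n+1)` with `|a| = d`, in the order dual to the lexicographic order, so
that lexicographically larger exponents come first. -/
def exponents (n d : ℕ) : Finset (Lex (Fin (n + 1) → ℕ))ᵒᵈ :=
  ((Finset.univ : Finset (Fin (n + 1))).piAntidiag d).map
    (toLex.trans OrderDual.toDual).toEmbedding

theorem card_exponents (n d : ℕ) : (exponents n d).card = k n d + 1 := by
  have h1 : 0 < (n + d).choose n := Nat.choose_pos (Nat.le_add_right n d)
  rw [exponents, Finset.card_map, k, Nat.sub_add_cancel h1]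
  have h2 := Finset.card_finsuppAntidiag_nat_eq_choose
    (s := (Finset.univ : Finset (Fin (n + 1)))) d
  rw [Finset.finsuppAntidiag, Finset.card_map, Finset.card_attach, Finset.card_fin] at h2
  rw [h2, Nat.add_right_comm, Nat.add_sub_cancel, ← Nat.choose_symm_add]

/-- The exponents `α_0, ..., α_k` of the monomials of degree `d` in `X_0, ..., X_n`, listed
lexicographically with `X_0 > X_1 > ... > X_n`. Thus `α_0 = (d, 0, ..., 0)` and
`α_k = (0, ..., 0, d)`. -/
def α (n d : ℕ) (i : Fin (k n d + 1)) : Fin (n + 1) → ℕ :=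
  ofLex (OrderDual.ofDual ((exponents n d).orderEmbOfFin (card_exponents n d) i))

/-- The monomial `m_i = X^(α_i)`, as a function of `x ∈ ℂ^(n+1)`. -/
def m (n d : ℕ) (i : Fin (k n d + 1)) (x : Fin (n + 1) → ℂ) : ℂ :=
  ∏ j, x j ^ α n d i j

/-- The index `n + i` in `{0, ..., k}`, for `i` in `{0, ..., k - n}`. -/
def top (n d : ℕ) (i : Fin (k n d + 1 - n)) : Fin (k n d + 1) :=
  ⟨n + i, by have := i.isLt; omega⟩

/-- `H_i`: the points `[z]` of `ℙ^k` such that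
`(z_0, ..., z_{n+i}) = (m_0(x), ..., m_{n+i}(x))` for some `x ∈ ℂ^(n+1)`. -/
def H (n d : ℕ) (i : Fin (k n d + 1 - n)) : Set (ProjSpace (k n d)) :=
  {p | ∃ (z : Fin (k n d + 1) → ℂ) (hz : z ≠ 0), ProjSpace.mk z hz = p ∧
    ∃ x : Fin (n + 1) → ℂ, ∀ j ≤ top n d i, z j = m n d j x}

/-- `V_i`: the Zariski closure of `H_i`. -/
def V (n d : ℕ) (i : Fin (k n d + 1 - n)) : Set (ProjSpace (k n d)) := closure (H n d i)

/-- The indices `s ∈ {1, ..., k}` for which there is `t ∈ {s, ..., k}` with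
`α_s + α_t = α_0 + α_{n+i}`. -/
def splittings (n d : ℕ) (i : Fin (k n d + 1 - n)) : Set (Fin (k n d + 1)) :=
  {s | 0 < s ∧ ∃ t, s ≤ t ∧ α n d s + α n d t = α n d 0 + α n d (top n d i)}

/-- For all `i ∈ {1, ..., k - n}`, `s_i` is the least element of `splittings n d i` and
`t_i ∈ {s_i, ..., k}` satisfies `α_{s_i} + α_{t_i} = α_0 + α_{n+i}`. (The values at `i = 0` play no
role.) -/
def IsChoice (n d : ℕ) (s t : Fin (k n d + 1 - n) → Fin (k n d + 1)) : Prop :=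
  ∀ i : Fin (k n d + 1 - n), 0 < (i : ℕ) → IsLeast (splittings n d i) (s i) ∧ s i ≤ t i ∧
    α n d (s i) + α n d (t i) = α n d 0 + α n d (top n d i)

/-- The quadratic form `q_i = Z_0 Z_{n+i} - Z_{s_i} Z_{t_i}`. -/
def q (n d : ℕ) (s t : Fin (k n d + 1 - n) → Fin (k n d + 1)) (i : Fin (k n d + 1 - n)) :
    MvPolynomial (Fin (k n d + 1)) ℂ :=
  X 0 * X (top n d i) - X (s i) * X (t i)

/-- `f(1, Z_1, ..., Z_k)`, a polynomial in `k` variables: `Z_1, ..., Z_k` are `X 0, ..., X (k-1)`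
here. -/
def dehomogenize {k : ℕ} (f : MvPolynomial (Fin (k + 1)) ℂ) : MvPolynomial (Fin k) ℂ :=
  aeval (Fin.cons 1 X : Fin (k + 1) → MvPolynomial (Fin k) ℂ) f

/-- `K_i`: the set of common zeros in `ℂ^k` of `q_1(1, Z_1, ..., Z_k), ..., q_i(1, Z_1, ..., Z_k)`;
for `i = 0` this is `ℂ^k`. -/
def K (n d : ℕ) (s t : Fin (k n d + 1 - n) → Fin (k n d + 1)) (i : Fin (k n d + 1 - n)) :
    Set (Fin (k n d) → ℂ) :=
  {z | ∀ j : Fin (k n d + 1 - n), 0 < (j : ℕ) → j ≤ i → eval z (dehomogenize (q n d s t j)) = 0}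

/-- The embedding `ℂ^k → ℙ^k`, `(z_1, ..., z_k) ↦ [1 : z_1 : ... : z_k]`. -/
def φ {k : ℕ} (z : Fin k → ℂ) : ProjSpace k :=
  ProjSpace.mk (Fin.cons 1 z) (fun h => one_ne_zero (congrFun h 0))

/-- `W_i`: the Zariski closure in `ℙ^k` of the image of `K_i` under the embedding. -/
def W (n d : ℕ) (s t : Fin (k n d + 1 - n) → Fin (k n d + 1)) (i : Fin (k n d + 1 - n)) :
    Set (ProjSpace (k n d)) :=
  closure (φ '' K n d s t i)

end Veronese

end

/-!
On the chart `Z_0 = 1` the equation `q_j = 0` reads `Z_{n+j} = Z_{s_j} Z_{t_j}`. Since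
`α_{s_j}` and `α_{t_j}` add up to `α_0 + α_{n+j}` and both are lexicographically smaller than `α_0`,
both are larger than `α_{n+j}`, that is, `s_j, t_j < n + j` (`Veronese.IsChoice.lt_top`). As
`α_0, ..., α_n` are the exponents of `X_0^d, X_0^(d-1) X_1, ..., X_0^(d-1) X_n`
(`Veronese.α_low`), induction shows that `K_i` is the graph given by
`Z_j = m_j(1, Z_1, ..., Z_n)` for `j ≤ n + i` (`Veronese.mem_K_iff`).

Therefore the image of `K_i` in `ℙ^k` consists of points of `H_i`, and it contains those given by
some `x` with `x_0 ≠ 0`, by rescaling. The remaining points of `H_i` are limits for `x_0 → 0`, and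
forms are continuous, so `V_i = W_i` (`Veronese.V_eq_W`).

The graph `K_i` is parametrized by polynomials, so its closure is irreducible
(`Veronese.isIrreducible_W`). The strictly decreasing sets `W_0, ..., W_i`
(`Veronese.W_ssubset_W`) show that the codimension of `W_i` is at least `i`. Conversely, a chain of
irreducible closed sets above `W_i` meets the chart `Z_0 ≠ 0`, and there it yields a chain of primes
of `ℂ[Z_1, ..., Z_k]` below the ideal of `K_i` (`Veronese.irredCodim_le_height`). This ideal is
generated by the `i` polynomials `Z_{n+j} - m_{n+j}(1, Z_1, ..., Z_n)`
(`Veronese.affineIdeal_W`), so by Krull's height theorem its height is at most `i`.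
-/

noncomputable section

namespace Veronese

/-! ### Exponents and splittings -/

theorem sum_α (n d : ℕ) (i : Fin (k n d + 1)) : ∑ l, α n d i l = d := by
  have h := Finset.orderEmbOfFin_mem (exponents n d) (card_exponents n d) i
  obtain ⟨a, ha, hai⟩ := Finset.mem_map.mp h
  have hα : α n d i = a := by rw [α, ← hai]; rfl
  rw [hα]
  exact (Finset.mem_piAntidiag.mp ha).1

theorem exists_α_eq {n d : ℕ} {a : Fin (n + 1) → ℕ} (ha : ∑ l, a l = d) :
    ∃ i, α n d i = a := by
  have h : OrderDual.toDual (toLex a) ∈ Set.range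
      ((exponents n d).orderEmbOfFin (card_exponents n d)) := by
    rw [Finset.range_orderEmbOfFin]
    exact Finset.mem_map.mpr ⟨a, Finset.mem_piAntidiag.mpr ⟨ha, by simp⟩, rfl⟩
  obtain ⟨i, hi⟩ := h
  exact ⟨i, by rw [α, hi]; rfl⟩

theorem toLex_α_lt_iff {n d : ℕ} {i j : Fin (k n d + 1)} :
    toLex (α n d i) < toLex (α n d j) ↔ j < i :=
  ((exponents n d).orderEmbOfFin (card_exponents n d)).lt_iff_lt (a := j) (b := i)

theorem α_injective (n d : ℕ) : Function.Injective (α n d) := by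
  intro i j h
  by_contra hij
  rcases lt_or_gt_of_ne hij with h' | h'
  · exact (toLex_α_lt_iff.mpr h').ne (by rw [h])
  · exact (toLex_α_lt_iff.mpr h').ne (by rw [h])

/-- The inclusion of the indices `0, ..., n` into `0, ..., k`. -/
def low {n d : ℕ} (hnk : n ≤ k n d) : Fin (n + 1) → Fin (k n d + 1) :=
  Fin.castLE (Nat.succ_le_succ hnk)

/-- The exponents `α_0, ..., α_n` are those of `X_0^d, X_0^(d-1) X_1, ..., X_0^(d-1) X_n`: these
exponents are listed in decreasing order and every larger exponent is one of them. -/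
theorem α_low {n d : ℕ} (hd : 1 ≤ d) (hnk : n ≤ k n d) (l : Fin (n + 1)) :
    α n d (low hnk l) = Pi.single 0 (d - 1) + Pi.single l 1 := by
  have hsum : ∀ l : Fin (n + 1),
      ∑ p, (Pi.single 0 (d - 1) + Pi.single l 1 : Fin (n + 1) → ℕ) p = d := by
    intro l
    simp only [Pi.add_apply, Finset.sum_add_distrib, Pi.single_apply, Finset.sum_ite_eq',
      Finset.mem_univ, if_true]
    omega
  choose f hf using fun l => exists_α_eq (hsum l)
  have hmono : StrictMono f := by
    intro l l' hl
    rw [← toLex_α_lt_iff, hf, hf]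
    refine ⟨l, fun j hj => ?_, ?_⟩
    · simp [hj.ne, (hj.trans hl).ne]
    · simp [hl.ne]
  have hlower : ∀ l j, j < f l → j ∈ Set.range f := by
    intro l j hj
    rw [← toLex_α_lt_iff, hf] at hj
    obtain ⟨p, hp, hp'⟩ := hj
    have h0 : d - 1 ≤ α n d j 0 := by
      rcases eq_or_ne p 0 with rfl | hp0
      · refine le_trans ?_ hp'.le
        simp
      · have := hp 0 (Fin.pos_iff_ne_zero.mpr hp0)
        simp only [Pi.toLex_apply, Pi.add_apply, Pi.single_eq_same] at this
        omega
    have hle : Pi.single 0 (d - 1) ≤ α n d j := by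
      intro q
      rcases eq_or_ne q 0 with rfl | hq
      · simpa using h0
      · simp [hq]
    obtain ⟨g, hg⟩ := exists_add_of_le hle
    have hgs : ∑ q, g q = 1 := by
      have h1 := sum_α n d j
      rw [hg] at h1
      simp only [Pi.add_apply, Finset.sum_add_distrib, Pi.single_apply, Finset.sum_ite_eq',
        Finset.mem_univ, if_true] at h1
      omega
    obtain ⟨l', -, hl'⟩ := Finset.exists_ne_zero_of_sum_ne_zero (hgs.trans_ne one_ne_zero)
    have hle' : Pi.single l' 1 ≤ g := by
      intro q
      rcases eq_or_ne q l' with rfl | hq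
      · simpa using Nat.one_le_iff_ne_zero.mpr hl'
      · simp [hq]
    obtain ⟨g', hg'⟩ := exists_add_of_le hle'
    have hg0 : ∑ q, g' q = 0 := by
      rw [hg'] at hgs
      simp only [Pi.add_apply, Finset.sum_add_distrib, Pi.single_apply, Finset.sum_ite_eq',
        Finset.mem_univ, if_true] at hgs
      omega
    have hg'0 : g' = 0 := by
      funext q
      exact Finset.sum_eq_zero_iff.mp hg0 q (Finset.mem_univ q)
    exact ⟨l', α_injective n d (by rw [hf, hg, hg', hg'0, add_zero])⟩
  -- `f` and the inclusion are both initial segments of a well-order, so they coincide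
  let F : InitialSeg (α := Fin (n + 1)) (β := Fin (k n d + 1)) (· < ·) (· < ·) :=
    ⟨(OrderEmbedding.ofStrictMono f hmono).ltEmbedding, fun l j hj => hlower l j hj⟩
  let G : InitialSeg (α := Fin (n + 1)) (β := Fin (k n d + 1)) (· < ·) (· < ·) :=
    ⟨(Fin.castLEOrderEmb (Nat.succ_le_succ hnk)).ltEmbedding, fun l j hj =>
      ⟨⟨j, lt_trans (Fin.lt_def.mp hj) l.isLt⟩, rfl⟩⟩
  have hFG : f l = low hnk l := F.eq G l
  rw [← hFG, hf]

theorem le_k_of_fin {n d : ℕ} (i : Fin (k n d + 1 - n)) : n ≤ k n d := by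
  have := i.isLt
  omega

theorem low_zero {n d : ℕ} (hnk : n ≤ k n d) : low hnk 0 = 0 := rfl

theorem α_zero {n d : ℕ} (hd : 1 ≤ d) (hnk : n ≤ k n d) : α n d 0 = Pi.single 0 d := by
  rw [← low_zero hnk, α_low hd, ← Pi.single_add, Nat.sub_add_cancel hd]

/-- If `α_(n+i)` contains the variable `X_l` with `l ≥ 1`, then
`α_0 + α_(n+i) = α_l + (α_(n+i) + e_0 - e_l)`. -/
theorem splittings_nonempty {n d : ℕ} (hd : 1 ≤ d) (i : Fin (k n d + 1 - n))
    (hi : 0 < (i : ℕ)) : (splittings n d i).Nonempty := by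
  have hnk := le_k_of_fin i
  have hne : ∀ l, top n d i ≠ low hnk l := by
    intro l h
    have h1 : n + (i : ℕ) = l := congrArg Fin.val h
    have := l.isLt
    omega
  obtain ⟨l, hl0, hl⟩ : ∃ l, l ≠ 0 ∧ α n d (top n d i) l ≠ 0 := by
    by_contra! hcon
    have h2 : α n d (top n d i) = Pi.single 0 d := by
      have h3 := sum_α n d (top n d i)
      rw [Finset.sum_eq_single 0 (fun l _ hl => hcon l hl) (by simp)] at h3
      funext l
      rcases eq_or_ne l 0 with rfl | hl
      · simpa using h3
      · simpa [hl] using hcon l hl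
    exact hne 0 (α_injective n d (by rw [low_zero, h2, α_zero hd hnk]))
  have hle : Pi.single l 1 ≤ α n d (top n d i) := by
    intro q
    rcases eq_or_ne q l with rfl | hq
    · simpa using Nat.one_le_iff_ne_zero.mpr hl
    · simp [hq]
  obtain ⟨g, hg⟩ := exists_add_of_le hle
  have hgs : ∑ q, (Pi.single 0 1 + g : Fin (n + 1) → ℕ) q = d := by
    have h1 := sum_α n d (top n d i)
    rw [hg] at h1
    simp only [Pi.add_apply, Finset.sum_add_distrib, Pi.single_apply, Finset.sum_ite_eq',
      Finset.mem_univ, if_true] at h1 ⊢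
    exact h1
  obtain ⟨t, ht⟩ := exists_α_eq hgs
  have hadd : α n d (low hnk l) + α n d t = α n d 0 + α n d (top n d i) := by
    have h1 : (Pi.single 0 d : Fin (n + 1) → ℕ) = Pi.single 0 (d - 1) + Pi.single 0 1 := by
      rw [← Pi.single_add, Nat.sub_add_cancel hd]
    rw [α_low hd, ht, α_zero hd hnk, hg, h1]
    abel
  have hl_pos : 0 < low hnk l := Fin.pos_of_ne_zero fun h =>
    hl0 (Fin.castLE_injective _ h)
  have ht_pos : 0 < t := by
    refine Fin.pos_of_ne_zero fun h => hne l (α_injective n d ?_)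
    subst h
    exact (add_left_cancel ((add_comm _ _).trans hadd)).symm
  rcases le_total (low hnk l) t with h | h
  · exact ⟨_, hl_pos, t, h, hadd⟩
  · exact ⟨_, ht_pos, _, h, (add_comm _ _).trans hadd⟩

theorem exists_isChoice {n d : ℕ} (hd : 1 ≤ d) : ∃ s t, IsChoice n d s t := by
  have h : ∀ i : Fin (k n d + 1 - n), ∃ s t : Fin (k n d + 1), 0 < (i : ℕ) →
      IsLeast (splittings n d i) s ∧ s ≤ t ∧
        α n d s + α n d t = α n d 0 + α n d (top n d i) := by
    intro i
    by_cases hi : 0 < (i : ℕ)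
    · obtain ⟨s, hs, hmin⟩ :=
        (Set.toFinite (splittings n d i)).exists_minimal (splittings_nonempty hd i hi)
      obtain ⟨t, hst, ht⟩ := hs.2
      exact ⟨s, t, fun _ => ⟨⟨hs, fun r hr => (le_total s r).elim id (hmin hr)⟩, hst, ht⟩⟩
    · exact ⟨0, 0, fun h => absurd h hi⟩
  choose s t hst using h
  exact ⟨s, t, hst⟩

/-- Since `α_u < α_0` lexicographically, `α_v` has to be larger than `α_w`. -/
theorem lt_of_α_add_eq {n d : ℕ} {u v w : Fin (k n d + 1)} (hu : 0 < u)
    (h : α n d u + α n d v = α n d 0 + α n d w) : v < w := by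
  rw [← toLex_α_lt_iff]
  have h1 := toLex_α_lt_iff.mpr hu
  by_contra hcon
  have h2 := add_lt_add_of_lt_of_le h1 (not_lt.mp hcon)
  exact h2.ne (congrArg toLex h)

theorem IsChoice.lt_top {n d : ℕ} {s t : Fin (k n d + 1 - n) → Fin (k n d + 1)}
    (h : IsChoice n d s t) {i : Fin (k n d + 1 - n)} (hi : 0 < (i : ℕ)) :
    s i < top n d i ∧ t i < top n d i := by
  obtain ⟨⟨⟨hs, -⟩, -⟩, hst, hadd⟩ := h i hi
  have ht := lt_of_α_add_eq hs hadd
  exact ⟨hst.trans_lt ht, ht⟩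

end Veronese

/-! ### The Zariski topology in terms of forms -/

theorem ProjSpace.isClosed_iff {k : ℕ} {Y : Set (ProjSpace k)} :
    IsClosed Y ↔ ∃ S : Set (MvPolynomial (Fin (k + 1)) ℂ),
      (∀ f ∈ S, IsForm f) ∧ Y = projZeroLocus S := by
  rw [← isOpen_compl_iff]
  change Yᶜᶜ ∈ _ ↔ _
  rw [compl_compl]
  rfl

theorem IsForm.isClosed_projZeroLocus {k : ℕ} {f : MvPolynomial (Fin (k + 1)) ℂ} (hf : IsForm f) :
    IsClosed (projZeroLocus {f}) :=
  ProjSpace.isClosed_iff.mpr ⟨{f}, by simpa, rfl⟩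

theorem ProjSpace.mem_closure_iff {k : ℕ} {A : Set (ProjSpace k)} {p : ProjSpace k} :
    p ∈ closure A ↔ ∀ f, IsForm f → (∀ q ∈ A, eval q.rep f = 0) → eval p.rep f = 0 := by
  constructor
  · intro hp f hf hA
    exact closure_minimal (t := projZeroLocus {f})
      (fun q hq g hg => by rw [Set.mem_singleton_iff.mp hg]; exact hA q hq)
      hf.isClosed_projZeroLocus hp f rfl
  · intro h
    obtain ⟨S, hS, hcl⟩ := ProjSpace.isClosed_iff.mp (isClosed_closure (s := A))
    rw [hcl]
    intro f hf
    refine h f (hS f hf) fun q hq => ?_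
    have h2 : q ∈ projZeroLocus S := hcl ▸ subset_closure hq
    exact h2 f hf

theorem IsForm.X {k : ℕ} (j : Fin (k + 1)) : IsForm (X j : MvPolynomial (Fin (k + 1)) ℂ) :=
  ⟨1, isHomogeneous_X _ _⟩

theorem IsForm.mul {k : ℕ} {f g : MvPolynomial (Fin (k + 1)) ℂ} (hf : IsForm f) (hg : IsForm g) :
    IsForm (f * g) := by
  obtain ⟨a, ha⟩ := hf
  obtain ⟨b, hb⟩ := hg
  exact ⟨a + b, ha.mul hb⟩

namespace Veronese

theorem eval_dehomogenize {k : ℕ} (z : Fin k → ℂ) (f : MvPolynomial (Fin (k + 1)) ℂ) :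
    eval z (dehomogenize f) = eval (Fin.cons 1 z : Fin (k + 1) → ℂ) f := by
  induction f using MvPolynomial.induction_on with
  | C a => simp [dehomogenize]
  | add f g hf hg => rw [map_add, ← hf, ← hg, dehomogenize, map_add, map_add]; rfl
  | mul_X f j hf =>
    rw [map_mul, ← hf, dehomogenize, map_mul, map_mul, aeval_X, eval_X]
    refine congrArg _ ?_
    refine Fin.cases ?_ (fun j => ?_) j <;> simp

theorem eval_rep_φ_eq_zero_iff {k : ℕ} {f : MvPolynomial (Fin (k + 1)) ℂ} (hf : IsForm f)
    (z : Fin k → ℂ) : eval (φ z).rep f = 0 ↔ eval (Fin.cons 1 z : Fin (k + 1) → ℂ) f = 0 :=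
  ProjSpace.eval_rep_mk_eq_zero_iff hf _ _

theorem mk_eq_φ {k : ℕ} {z : Fin (k + 1) → ℂ} (hz : z ≠ 0) (h0 : z 0 ≠ 0) :
    ProjSpace.mk z hz = φ fun j => (z 0)⁻¹ * z j.succ := by
  refine (Projectivization.mk_eq_mk_iff' ℂ _ _ _ _).mpr ⟨z 0, ?_⟩
  funext j
  refine Fin.cases ?_ (fun j => ?_) j
  · simp
  · simp [h0]

/-! ### The graph `K_i` and the equality of the two closures -/

theorem m_low {n d : ℕ} (hd : 1 ≤ d) (hnk : n ≤ k n d) (l : Fin (n + 1)) (x : Fin (n + 1) → ℂ) :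
    m n d (low hnk l) x = x 0 ^ (d - 1) * x l := by
  simp only [m, α_low hd hnk, Pi.add_apply, pow_add, Finset.prod_mul_distrib, Pi.single_apply,
    pow_ite, pow_zero, pow_one, Finset.prod_ite_eq', Finset.mem_univ, if_true]

theorem m_zero {n d : ℕ} (hd : 1 ≤ d) (hnk : n ≤ k n d) (x : Fin (n + 1) → ℂ) :
    m n d 0 x = x 0 ^ d := by
  rw [← low_zero hnk, m_low hd, ← pow_succ, Nat.sub_add_cancel hd]

theorem m_mul_m {n d : ℕ} {a b u v : Fin (k n d + 1)}
    (h : α n d a + α n d b = α n d u + α n d v) (x : Fin (n + 1) → ℂ) :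
    m n d a x * m n d b x = m n d u x * m n d v x := by
  simp only [m, ← Finset.prod_mul_distrib, ← pow_add]
  exact Finset.prod_congr rfl fun l _ => congrArg (x l ^ ·) (congrFun h l)

theorem m_smul {n d : ℕ} (j : Fin (k n d + 1)) (c : ℂ) (x : Fin (n + 1) → ℂ) :
    m n d j (fun l => c * x l) = c ^ d * m n d j x := by
  simp only [m, mul_pow, Finset.prod_mul_distrib, Finset.prod_pow_eq_pow_sum, sum_α]

theorem exists_low_or_top {n d : ℕ} (hnk : n ≤ k n d) (j : Fin (k n d + 1)) :
    (∃ l, low hnk l = j) ∨ ∃ i : Fin (k n d + 1 - n), 0 < (i : ℕ) ∧ top n d i = j := by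
  by_cases h : (j : ℕ) < n + 1
  · exact Or.inl ⟨⟨j, h⟩, rfl⟩
  · have := j.isLt
    exact Or.inr ⟨⟨j - n, by omega⟩, by simp only; omega, Fin.ext (by simp only [top]; omega)⟩

theorem top_le_top_iff {n d : ℕ} {i j : Fin (k n d + 1 - n)} :
    top n d i ≤ top n d j ↔ i ≤ j := by
  simp [top]

theorem top_lt_top_iff {n d : ℕ} {i j : Fin (k n d + 1 - n)} :
    top n d i < top n d j ↔ i < j := by
  simp [top]

/-- On `Z_0 = 1` the equation `q_j = 0` reads `Z_{n+j} = Z_{s_j} Z_{t_j}` with `s_j, t_j < n + j`,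
so that `K_i` is the graph `Z_j = m_j(1, Z_1, ..., Z_n)` (`j ≤ n + i`). -/
theorem mem_K_iff {n d : ℕ} (hd : 1 ≤ d) (hnk : n ≤ k n d)
    {s t : Fin (k n d + 1 - n) → Fin (k n d + 1)} (hst : IsChoice n d s t)
    {i : Fin (k n d + 1 - n)} {z : Fin (k n d) → ℂ} :
    z ∈ K n d s t i ↔ ∀ j ≤ top n d i, (Fin.cons 1 z : Fin (k n d + 1) → ℂ) j =
      m n d j fun l => (Fin.cons 1 z : Fin (k n d + 1) → ℂ) (low hnk l) := by
  set Z : Fin (k n d + 1) → ℂ := Fin.cons 1 z with hZ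
  have hK : z ∈ K n d s t i ↔ ∀ j : Fin (k n d + 1 - n), 0 < (j : ℕ) → j ≤ i →
      Z (top n d j) = Z (s j) * Z (t j) := by
    refine forall_congr' fun j => forall₂_congr fun _ _ => ?_
    rw [eval_dehomogenize, ← hZ]
    simp [q, hZ, sub_eq_zero]
  have hm0 : (m n d 0 fun l => Z (low hnk l)) = 1 := by
    rw [m_zero hd hnk, low_zero, hZ, Fin.cons_zero, one_pow]
  rw [hK]
  constructor
  · intro h j
    induction j using WellFoundedLT.induction with
    | ind j ih =>
      intro hj
      rcases exists_low_or_top hnk j with ⟨l, rfl⟩ | ⟨r, hr, rfl⟩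
      · rw [m_low hd, low_zero, hZ, Fin.cons_zero, one_pow, one_mul]
      · obtain ⟨hs, ht⟩ := hst.lt_top hr
        rw [h r hr (top_le_top_iff.mp hj), ih _ hs (hs.le.trans hj), ih _ ht (ht.le.trans hj),
          m_mul_m (hst r hr).2.2, hm0, one_mul]
  · intro h r hr hri
    obtain ⟨hs, ht⟩ := hst.lt_top hr
    have htop := top_le_top_iff.mpr hri
    rw [h _ htop, h _ (hs.le.trans htop), h _ (ht.le.trans htop), m_mul_m (hst r hr).2.2, hm0,
      one_mul]

theorem φ_K_subset_H {n d : ℕ} (hd : 1 ≤ d)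
    {s t : Fin (k n d + 1 - n) → Fin (k n d + 1)} (hst : IsChoice n d s t)
    (i : Fin (k n d + 1 - n)) : φ '' K n d s t i ⊆ H n d i := by
  rintro _ ⟨z, hz, rfl⟩
  exact ⟨_, _, rfl, _, (mem_K_iff hd (le_k_of_fin i) hst).mp hz⟩

/-- The points of `H_i` with `x_0 ≠ 0` lie in the image of `K_i`: rescale `x` to `x_0 = 1`. -/
theorem mk_mem_φ_K {n d : ℕ} (hd : 1 ≤ d)
    {s t : Fin (k n d + 1 - n) → Fin (k n d + 1)} (hst : IsChoice n d s t)
    {i : Fin (k n d + 1 - n)} {z : Fin (k n d + 1) → ℂ} (hz : z ≠ 0) {x : Fin (n + 1) → ℂ}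
    (hx : x 0 ≠ 0) (hzx : ∀ j ≤ top n d i, z j = m n d j x) :
    ProjSpace.mk z hz ∈ φ '' K n d s t i := by
  have hnk := le_k_of_fin i
  have hz0 : z 0 = x 0 ^ d := by rw [hzx 0 (Fin.zero_le _), m_zero hd hnk]
  have h0 : z 0 ≠ 0 := hz0 ▸ pow_ne_zero d hx
  have hcons : ∀ j, (Fin.cons 1 (fun j : Fin (k n d) => (z 0)⁻¹ * z j.succ) :
      Fin (k n d + 1) → ℂ) j = (z 0)⁻¹ * z j := by
    intro j
    refine Fin.cases ?_ (fun j => ?_) j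
    · simp [h0]
    · simp
  refine ⟨_, (mem_K_iff hd hnk hst).mpr fun j hj => ?_, (mk_eq_φ hz h0).symm⟩
  have hlow : ∀ l, (z 0)⁻¹ * z (low hnk l) = (x 0)⁻¹ * x l := by
    intro l
    have hl : low hnk l ≤ top n d i := by
      have := l.isLt
      simp only [low, top, Fin.le_def, Fin.val_castLE]
      omega
    rw [hzx _ hl, m_low hd, hz0, ← Nat.sub_add_cancel hd, pow_succ, Nat.add_sub_cancel]
    field_simp
  have hfun : (fun l => (Fin.cons 1 (fun j : Fin (k n d) => (z 0)⁻¹ * z j.succ) :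
      Fin (k n d + 1) → ℂ) (low hnk l)) = fun l => (x 0)⁻¹ * x l :=
    funext fun l => (hcons _).trans (hlow l)
  rw [hcons, hfun, m_smul, hzx j hj, hz0, inv_pow]

/-- A point of `H_i` given by `x` with `x_0 = 0` is a limit of the points of `φ(K_i)` obtained by
replacing `x_0` with `ε → 0`; a form vanishing on `φ(K_i)` vanishes there by continuity. -/
theorem H_subset_closure {n d : ℕ} (hd : 1 ≤ d)
    {s t : Fin (k n d + 1 - n) → Fin (k n d + 1)} (hst : IsChoice n d s t)
    (i : Fin (k n d + 1 - n)) : H n d i ⊆ closure (φ '' K n d s t i) := by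
  rintro _ ⟨z, hz, rfl, x, hzx⟩
  rw [ProjSpace.mem_closure_iff]
  intro f hf hfK
  rw [ProjSpace.eval_rep_mk_eq_zero_iff hf]
  let w : ℂ → Fin (k n d + 1) → ℂ := fun ε j =>
    if j ≤ top n d i then m n d j (Function.update x 0 ε) else z j
  have hw : Continuous w := by
    refine continuous_pi fun j => ?_
    by_cases hj : j ≤ top n d i
    · simp only [w, hj, if_true, m]
      fun_prop
    · simp only [w, hj, if_false]
      fun_prop
  have hwx : w (x 0) = z := by
    funext j
    by_cases hj : j ≤ top n d i
    · simp [w, hj, hzx j hj]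
    · simp [w, hj]
  have hne : ∀ ε ∈ ({0}ᶜ : Set ℂ), eval (w ε) f = 0 := by
    intro ε hε
    have hw0 : w ε ≠ 0 := by
      intro h
      have h1 : w ε 0 = ε ^ d := by
        simp [w, m_zero hd (le_k_of_fin i)]
      rw [h] at h1
      exact pow_ne_zero d hε h1.symm
    rw [← ProjSpace.eval_rep_mk_eq_zero_iff hf _ hw0]
    refine hfK _ (mk_mem_φ_K hd hst hw0 (x := Function.update x 0 ε) (by simpa using hε) ?_)
    intro j hj
    simp [w, hj]
  have hcont : Continuous fun ε => eval (w ε) f := (MvPolynomial.continuous_eval f).comp hw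
  have h := hcont.ext_on (dense_compl_singleton 0) continuous_const hne
  rw [← hwx]
  exact congrFun h (x 0)

theorem V_eq_W {n d : ℕ} (hd : 1 ≤ d)
    {s t : Fin (k n d + 1 - n) → Fin (k n d + 1)} (hst : IsChoice n d s t)
    (i : Fin (k n d + 1 - n)) : V n d i = W n d s t i :=
  (closure_minimal (H_subset_closure hd hst i) isClosed_closure).antisymm
    (closure_mono (φ_K_subset_H hd hst i))

end Veronese

/-! ### Irreducible sets and primes in the affine chart -/

/-- Irreducibility can be tested on products of two forms, because the closed sets are the
intersections of zero sets of single forms. -/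
theorem ProjSpace.isPreirreducible_iff {k : ℕ} {A : Set (ProjSpace k)} :
    IsPreirreducible A ↔ ∀ f g, IsForm f → IsForm g → (∀ p ∈ A, eval p.rep (f * g) = 0) →
      (∀ p ∈ A, eval p.rep f = 0) ∨ ∀ p ∈ A, eval p.rep g = 0 := by
  rw [isPreirreducible_iff_isClosed_union_isClosed]
  constructor
  · intro h f g hf hg hfg
    refine (h _ _ hf.isClosed_projZeroLocus hg.isClosed_projZeroLocus fun p hp => ?_).imp (fun H p hp => H hp f rfl)
      (fun H p hp => H hp g rfl)
    have := hfg p hp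
    rw [map_mul, mul_eq_zero] at this
    simpa [projZeroLocus] using this
  · intro h Y Z hY hZ hA
    obtain ⟨S, hS, rfl⟩ := ProjSpace.isClosed_iff.mp hY
    obtain ⟨T, hT, rfl⟩ := ProjSpace.isClosed_iff.mp hZ
    by_contra! hcon
    obtain ⟨hAS, hAT⟩ := hcon
    obtain ⟨p, hp, hpS⟩ := Set.not_subset.mp hAS
    obtain ⟨r, hr, hrT⟩ := Set.not_subset.mp hAT
    simp only [projZeroLocus, Set.mem_ofPred_eq, not_forall] at hpS hrT
    obtain ⟨f, hf, hfp⟩ := hpS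
    obtain ⟨g, hg, hgr⟩ := hrT
    refine (h f g (hS f hf) (hT g hg) fun a ha => ?_).elim (fun H => hfp (H p hp))
      (fun H => hgr (H r hr))
    rw [map_mul, mul_eq_zero]
    exact (hA ha).imp (fun H => H f hf) (fun H => H g hg)

/-- Every polynomial in `Z_1, ..., Z_k` is the dehomogenization of a form. -/
theorem exists_isForm_eval_cons_one {k : ℕ} (f : MvPolynomial (Fin k) ℂ) :
    ∃ F : MvPolynomial (Fin (k + 1)) ℂ, IsForm F ∧
      ∀ z : Fin k → ℂ, eval (Fin.cons 1 z : Fin (k + 1) → ℂ) F = eval z f := by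
  refine ⟨∑ b ∈ f.support, C (coeff b f) *
    (X 0 ^ (f.totalDegree - b.sum fun _ e => e) * ∏ j, X j.succ ^ b j), ⟨f.totalDegree, ?_⟩, ?_⟩
  · refine IsHomogeneous.sum _ _ _ fun b hb => IsHomogeneous.C_mul ?_ _
    have h1 := (isHomogeneous_X_pow (R := ℂ) (0 : Fin (k + 1))
      (f.totalDegree - b.sum fun _ e => e)).mul
      (IsHomogeneous.prod (Finset.univ : Finset (Fin k)) (fun j => X j.succ ^ b j) (fun j => b j)
        fun j _ => isHomogeneous_X_pow (R := ℂ) (j.succ : Fin (k + 1)) (b j))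
    have h2 : ∑ j, b j = b.sum fun _ e => e := by
      rw [Finsupp.sum_fintype b (fun _ e => e) fun _ => rfl]
    rwa [h2, Nat.sub_add_cancel (le_totalDegree hb)] at h1
  · intro z
    rw [eval_eq' z f]
    simp

namespace Veronese

/-- The ideal of the polynomials in `Z_1, ..., Z_k` that vanish on the part of `Y` with
`Z_0 ≠ 0`. -/
def affineIdeal {k : ℕ} (Y : Set (ProjSpace k)) : Ideal (MvPolynomial (Fin k) ℂ) :=
  vanishingIdeal ℂ (φ ⁻¹' Y)

theorem mem_affineIdeal {k : ℕ} {Y : Set (ProjSpace k)} {f : MvPolynomial (Fin k) ℂ} :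
    f ∈ affineIdeal Y ↔ ∀ z, φ z ∈ Y → eval z f = 0 := by
  rw [affineIdeal, mem_vanishingIdeal_iff]
  rfl

theorem exists_φ_eq_of_rep_zero_ne_zero {k : ℕ} {p : ProjSpace k} (hp : p.rep 0 ≠ 0) :
    ∃ z, φ z = p := by
  refine ⟨_, (mk_eq_φ p.rep_ne_zero hp).symm.trans ?_⟩
  exact Projectivization.mk_rep (K := ℂ) (V := Fin (k + 1) → ℂ) p

theorem eval_rep_φ_X_zero_ne_zero {k : ℕ} (z : Fin k → ℂ) :
    eval (φ z).rep (X 0 : MvPolynomial (Fin (k + 1)) ℂ) ≠ 0 := by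
  rw [Ne, eval_rep_φ_eq_zero_iff (IsForm.X 0)]
  simp

/-- A form vanishes on the part of `Y` with `Z_0 ≠ 0` if and only if its product with `Z_0`
vanishes on `Y`. -/
theorem eval_X_zero_mul_eq_zero {k : ℕ} {Y : Set (ProjSpace k)}
    {F : MvPolynomial (Fin (k + 1)) ℂ} (h : ∀ z, φ z ∈ Y → eval (φ z).rep F = 0) :
    ∀ p ∈ Y, eval p.rep (X 0 * F) = 0 := by
  intro p hp
  rw [map_mul, mul_eq_zero, or_iff_not_imp_left, eval_X]
  intro h0
  obtain ⟨z, rfl⟩ := exists_φ_eq_of_rep_zero_ne_zero h0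
  exact h z hp

/-- If `f g` vanishes on the part of `Y` with `Z_0 ≠ 0`, then `Z_0 F G` vanishes on `Y`, where `F`
and `G` are homogenizations of `f` and `g`; irreducibility of `Y` yields that `Z_0 F` or `G`
vanishes on `Y`. -/
theorem isPrime_affineIdeal {k : ℕ} {Y : Set (ProjSpace k)} (hY : IsPreirreducible Y)
    {z₀ : Fin k → ℂ} (hz₀ : φ z₀ ∈ Y) : (affineIdeal Y).IsPrime := by
  refine ⟨fun h => ?_, fun {f g} hfg => ?_⟩
  · have h1 : (1 : MvPolynomial (Fin k) ℂ) ∈ affineIdeal Y := by simp [h]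
    simpa using mem_affineIdeal.mp h1 z₀ hz₀
  · rw [mem_affineIdeal] at hfg
    obtain ⟨F, hF, hFf⟩ := exists_isForm_eval_cons_one f
    obtain ⟨G, hG, hGg⟩ := exists_isForm_eval_cons_one g
    have h1 : ∀ p ∈ Y, eval p.rep (X 0 * F * G) = 0 := by
      rw [mul_assoc]
      refine eval_X_zero_mul_eq_zero fun z hz => ?_
      rw [eval_rep_φ_eq_zero_iff (hF.mul hG), map_mul, hFf, hGg, ← map_mul]
      exact hfg z hz
    refine (ProjSpace.isPreirreducible_iff.mp hY _ _ ((IsForm.X 0).mul hF) hG h1).imp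
      (fun H => mem_affineIdeal.mpr fun z hz => ?_) (fun H => mem_affineIdeal.mpr fun z hz => ?_)
    · have h2 := H _ hz
      rw [map_mul, mul_eq_zero, or_iff_right (eval_rep_φ_X_zero_ne_zero z),
        eval_rep_φ_eq_zero_iff hF, hFf] at h2
      exact h2
    · have h2 := H _ hz
      rwa [eval_rep_φ_eq_zero_iff hG, hGg] at h2

/-- An irreducible set that meets `Z_0 ≠ 0` is contained in every closed set that contains its
part with `Z_0 ≠ 0`; hence it is determined by that part. -/
theorem subset_of_affineIdeal_le {k : ℕ} {Y Y' : Set (ProjSpace k)} (hY : IsClosed Y)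
    (hY' : IsPreirreducible Y') {z₀ : Fin k → ℂ} (hz₀ : φ z₀ ∈ Y')
    (h : affineIdeal Y ≤ affineIdeal Y') : Y' ⊆ Y := by
  obtain ⟨S, hS, rfl⟩ := ProjSpace.isClosed_iff.mp hY
  intro p hp F hF
  have hFform := hS F hF
  have h1 : dehomogenize F ∈ affineIdeal (projZeroLocus S) := by
    refine mem_affineIdeal.mpr fun z hz => ?_
    rw [eval_dehomogenize, ← eval_rep_φ_eq_zero_iff hFform]
    exact hz F hF
  have h2 : ∀ p ∈ Y', eval p.rep (X 0 * F) = 0 := by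
    refine eval_X_zero_mul_eq_zero fun z hz => ?_
    rw [eval_rep_φ_eq_zero_iff hFform, ← eval_dehomogenize]
    exact mem_affineIdeal.mp (h h1) z hz
  exact (ProjSpace.isPreirreducible_iff.mp hY' _ _ (IsForm.X 0) hFform h2).elim
    (fun H => absurd (H _ hz₀) (eval_rep_φ_X_zero_ne_zero z₀)) (fun H => H p hp)

theorem affineIdeal_anti {k : ℕ} {Y Y' : Set (ProjSpace k)} (h : Y ⊆ Y') :
    affineIdeal Y' ≤ affineIdeal Y :=
  vanishingIdeal_anti_mono (Set.preimage_mono h)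

/-- Taking ideals turns a chain of irreducible closed sets above `Y` into a chain of primes below
the ideal of `Y`. -/
theorem irredCodim_le_height {k : ℕ} {Y : Set (ProjSpace k)} (hY : IsIrreducible Y)
    (hY' : IsClosed Y) {z₀ : Fin k → ℂ} (hz₀ : φ z₀ ∈ Y) :
    irredCodim Y hY hY' ≤ (affineIdeal Y).height := by
  refine Order.coheight_le fun c hc => ?_
  have hmem : ∀ j, φ z₀ ∈ (c j : Set (ProjSpace k)) := by
    intro j
    have h1 : c.head ≤ c j := c.monotone (Fin.zero_le j)
    rw [hc] at h1
    exact h1 hz₀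
  let e : LTSeries (PrimeSpectrum (MvPolynomial (Fin k) ℂ)) :=
    { length := c.length
      toFun := fun j => ⟨affineIdeal (c j.rev : Set (ProjSpace k)),
        isPrime_affineIdeal (c j.rev).isIrreducible.isPreirreducible (hmem _)⟩
      step := fun j => by
        have hlt : c j.succ.rev < c j.castSucc.rev :=
          c.strictMono (Fin.rev_lt_rev.mpr j.castSucc_lt_succ)
        refine lt_of_le_not_ge (affineIdeal_anti hlt.le) fun hle => ?_
        exact hlt.not_ge (subset_of_affineIdeal_le (c j.succ.rev).isClosed
          (c j.castSucc.rev).isIrreducible.isPreirreducible (hmem _) hle) }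
  have hp := isPrime_affineIdeal hY.isPreirreducible hz₀
  have hlast : e.last ≤ ⟨affineIdeal Y, hp⟩ := by
    change affineIdeal (c (Fin.last c.length).rev : Set (ProjSpace k)) ≤ affineIdeal Y
    rw [Fin.rev_last]
    exact affineIdeal_anti (congrArg SetLike.coe hc).ge
  exact (Order.length_le_height hlast).trans_eq
    (PrimeSpectrum.height_eq_orderHeight ⟨affineIdeal Y, hp⟩).symm

/-! ### The parametrization of `K_i` -/

/-- The polynomials parametrizing the graph `Z_j = m_j(1, Z_1, ..., Z_n)` (`j ≤ r`): the monomial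
`m_j(1, Z_1, ..., Z_n)` for `j ≤ r`, and `Z_j` itself for `j > r`. -/
def param {n d : ℕ} (hnk : n ≤ k n d) (r j : Fin (k n d + 1)) : MvPolynomial (Fin (k n d)) ℂ :=
  if j ≤ r then ∏ l, (Fin.cons 1 X : Fin (k n d + 1) → MvPolynomial (Fin (k n d)) ℂ)
    (low hnk l) ^ α n d j l
  else (Fin.cons 1 X : Fin (k n d + 1) → MvPolynomial (Fin (k n d)) ℂ) j

theorem eval_cons_one_X {k : ℕ} (z : Fin k → ℂ) (j : Fin (k + 1)) :
    eval z ((Fin.cons 1 X : Fin (k + 1) → MvPolynomial (Fin k) ℂ) j) =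
      (Fin.cons 1 z : Fin (k + 1) → ℂ) j := by
  refine Fin.cases ?_ (fun j => ?_) j <;> simp

theorem eval_param_of_le {n d : ℕ} (hnk : n ≤ k n d) {r j : Fin (k n d + 1)} (hj : j ≤ r)
    (z : Fin (k n d) → ℂ) : eval z (param hnk r j) =
      m n d j fun l => (Fin.cons 1 z : Fin (k n d + 1) → ℂ) (low hnk l) := by
  simp only [param, hj, if_true, map_prod, map_pow, eval_cons_one_X, m]

theorem param_of_not_le {n d : ℕ} (hnk : n ≤ k n d) {r j : Fin (k n d + 1)} (hj : ¬ j ≤ r) :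
    param hnk r j = (Fin.cons 1 X : Fin (k n d + 1) → MvPolynomial (Fin (k n d)) ℂ) j :=
  if_neg hj

theorem param_low {n d : ℕ} (hd : 1 ≤ d) (hnk : n ≤ k n d) (r : Fin (k n d + 1))
    (l : Fin (n + 1)) : param hnk r (low hnk l) =
      (Fin.cons 1 X : Fin (k n d + 1) → MvPolynomial (Fin (k n d)) ℂ) (low hnk l) := by
  by_cases hl : low hnk l ≤ r
  · refine MvPolynomial.funext fun z => ?_
    rw [eval_param_of_le hnk hl, m_low hd, low_zero, Fin.cons_zero, one_pow, one_mul,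
      eval_cons_one_X]
  · exact param_of_not_le hnk hl

/-- The point of the graph with parameters `z`; the coordinates `Z_j` of `z` with `n < j ≤ r` play
no role. -/
def paramPoint {n d : ℕ} (hnk : n ≤ k n d) (r : Fin (k n d + 1)) (z : Fin (k n d) → ℂ) :
    Fin (k n d) → ℂ :=
  fun j => eval z (param hnk r j.succ)

theorem cons_one_paramPoint {n d : ℕ} (hd : 1 ≤ d) (hnk : n ≤ k n d) (r : Fin (k n d + 1))
    (z : Fin (k n d) → ℂ) (j : Fin (k n d + 1)) :
    (Fin.cons 1 (paramPoint hnk r z) : Fin (k n d + 1) → ℂ) j = eval z (param hnk r j) := by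
  refine Fin.cases ?_ (fun j => rfl) j
  rw [← low_zero hnk, param_low hd, low_zero, Fin.cons_zero, Fin.cons_zero, map_one]

theorem cons_one_paramPoint_low {n d : ℕ} (hd : 1 ≤ d) (hnk : n ≤ k n d) (r : Fin (k n d + 1))
    (z : Fin (k n d) → ℂ) (l : Fin (n + 1)) :
    (Fin.cons 1 (paramPoint hnk r z) : Fin (k n d + 1) → ℂ) (low hnk l) =
      (Fin.cons 1 z : Fin (k n d + 1) → ℂ) (low hnk l) := by
  rw [cons_one_paramPoint hd, param_low hd, eval_cons_one_X]

variable {n d : ℕ} {s t : Fin (k n d + 1 - n) → Fin (k n d + 1)}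

theorem paramPoint_mem_K (hd : 1 ≤ d) (hnk : n ≤ k n d) (hst : IsChoice n d s t)
    (i : Fin (k n d + 1 - n)) (z : Fin (k n d) → ℂ) :
    paramPoint hnk (top n d i) z ∈ K n d s t i := by
  rw [mem_K_iff hd hnk hst]
  intro j hj
  simp only [cons_one_paramPoint_low hd]
  rw [cons_one_paramPoint hd, eval_param_of_le hnk hj]

theorem paramPoint_eq_of_mem_K (hd : 1 ≤ d) (hnk : n ≤ k n d) (hst : IsChoice n d s t)
    {i : Fin (k n d + 1 - n)} {z : Fin (k n d) → ℂ} (hz : z ∈ K n d s t i) :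
    paramPoint hnk (top n d i) z = z := by
  funext j
  rw [paramPoint]
  by_cases hj : j.succ ≤ top n d i
  · rw [eval_param_of_le hnk hj, ← (mem_K_iff hd hnk hst).mp hz _ hj, Fin.cons_succ]
  · rw [param_of_not_le hnk hj, Fin.cons_succ, eval_X]

/-- Substitution of the parametrization into a polynomial, the comorphism of `paramPoint`. -/
def substParam (hnk : n ≤ k n d) (r : Fin (k n d + 1)) :
    MvPolynomial (Fin (k n d)) ℂ →ₐ[ℂ] MvPolynomial (Fin (k n d)) ℂ :=
  aeval fun j => param hnk r j.succ

theorem eval_substParam (hnk : n ≤ k n d) (r : Fin (k n d + 1)) (z : Fin (k n d) → ℂ)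
    (f : MvPolynomial (Fin (k n d)) ℂ) :
    eval z (substParam hnk r f) = eval (paramPoint hnk r z) f := by
  induction f using MvPolynomial.induction_on with
  | C a => simp [substParam]
  | add f g hf hg => rw [map_add, map_add, map_add, hf, hg]
  | mul_X f j hf => rw [map_mul, map_mul, map_mul, hf, substParam, aeval_X, eval_X, paramPoint]

theorem eval_eq_zero_on_K_iff (hd : 1 ≤ d) (hnk : n ≤ k n d) (hst : IsChoice n d s t)
    (i : Fin (k n d + 1 - n)) (f : MvPolynomial (Fin (k n d)) ℂ) :
    (∀ z ∈ K n d s t i, eval z f = 0) ↔ substParam hnk (top n d i) f = 0 := by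
  constructor
  · intro h
    refine MvPolynomial.funext fun z => ?_
    rw [eval_substParam, map_zero]
    exact h _ (paramPoint_mem_K hd hnk hst i z)
  · intro h z hz
    rw [← paramPoint_eq_of_mem_K hd hnk hst hz, ← eval_substParam, h, map_zero]

/-- A form vanishes on `φ(K_i)` if and only if its image under the ring homomorphism
`f ↦ substParam (dehomogenize f)` is zero; the target being a domain, `W_i` is irreducible. -/
theorem isIrreducible_W (hd : 1 ≤ d) (hst : IsChoice n d s t) (i : Fin (k n d + 1 - n)) :
    IsIrreducible (W n d s t i) := by
  have hnk := le_k_of_fin i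
  rw [W, isIrreducible_iff_closure]
  refine ⟨⟨_, Set.mem_image_of_mem _ (paramPoint_mem_K hd hnk hst i 0)⟩, ?_⟩
  have hforms : ∀ f, IsForm f → ((∀ p ∈ φ '' K n d s t i, eval p.rep f = 0) ↔
      substParam hnk (top n d i) (dehomogenize f) = 0) := by
    intro f hf
    rw [← eval_eq_zero_on_K_iff hd hnk hst, Set.forall_mem_image]
    simp only [eval_rep_φ_eq_zero_iff hf, eval_dehomogenize]
  rw [ProjSpace.isPreirreducible_iff]
  intro f g hf hg hfg
  rw [hforms _ (hf.mul hg), dehomogenize, map_mul, map_mul, mul_eq_zero] at hfg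
  rwa [hforms f hf, hforms g hg]

/-! ### The ideal of `K_i` and the codimension of `W_i` -/

/-- The polynomials `Z_{n+j} - m_{n+j}(1, Z_1, ..., Z_n)` (`j = 1, ..., i`), which generate the
ideal of `K_i`. -/
def graphEquations (hnk : n ≤ k n d) (i : Fin (k n d + 1 - n)) :
    Finset (MvPolynomial (Fin (k n d)) ℂ) :=
  Finset.univ.image fun r : Fin (i : ℕ) =>
    let j : Fin (k n d) := ⟨n + r, by have := i.isLt; have := r.isLt; omega⟩
    X j - param hnk (top n d i) j.succ

theorem card_graphEquations_le (hnk : n ≤ k n d) (i : Fin (k n d + 1 - n)) :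
    (graphEquations hnk i).card ≤ i :=
  Finset.card_image_le.trans_eq (Finset.card_fin _)

/-- Modulo the equations of the graph, every polynomial is equivalent to the one obtained by
substituting the parametrization. -/
theorem sub_substParam_mem_span (hd : 1 ≤ d) (hnk : n ≤ k n d) (i : Fin (k n d + 1 - n))
    (f : MvPolynomial (Fin (k n d)) ℂ) : f - substParam hnk (top n d i) f ∈
      Ideal.span (graphEquations hnk i : Set (MvPolynomial (Fin (k n d)) ℂ)) := by
  set I := Ideal.span (graphEquations hnk i : Set (MvPolynomial (Fin (k n d)) ℂ))
  have h : Ideal.Quotient.mkₐ ℂ I = (Ideal.Quotient.mkₐ ℂ I).comp (substParam hnk (top n d i)) := by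
    refine MvPolynomial.algHom_ext fun j => ?_
    rw [AlgHom.comp_apply, substParam, aeval_X]
    refine (Ideal.Quotient.mk_eq_mk_iff_sub_mem _ _).mpr ?_
    rcases exists_low_or_top hnk j.succ with ⟨l, hl⟩ | ⟨r, hr, hrj⟩
    · rw [← hl, param_low hd, hl, Fin.cons_succ, sub_self]
      exact I.zero_mem
    · by_cases hj : j.succ ≤ top n d i
      · have h1 : n + (r : ℕ) = j + 1 := congrArg Fin.val hrj
        have h2 : (j : ℕ) + 1 ≤ n + i := hj
        refine Ideal.subset_span (Finset.mem_coe.mpr (Finset.mem_image.mpr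
          ⟨⟨r - 1, by omega⟩, Finset.mem_univ _, ?_⟩))
        have h3 : (⟨n + (r - 1), by have := j.isLt; omega⟩ : Fin (k n d)) = j :=
          Fin.ext (by simp only; omega)
        simp only [h3]
      · rw [param_of_not_le hnk hj, Fin.cons_succ, sub_self]
        exact I.zero_mem
  exact (Ideal.Quotient.mk_eq_mk_iff_sub_mem _ _).mp (DFunLike.congr_fun h f)

theorem φ_mem_W {i : Fin (k n d + 1 - n)} {z : Fin (k n d) → ℂ} (hz : z ∈ K n d s t i) :
    φ z ∈ W n d s t i :=
  subset_closure (Set.mem_image_of_mem _ hz)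

theorem form_eq_zero_on_W {i : Fin (k n d + 1 - n)} {f : MvPolynomial (Fin (k n d + 1)) ℂ}
    (hf : IsForm f) (h : ∀ z ∈ K n d s t i, eval z (dehomogenize f) = 0) {z : Fin (k n d) → ℂ}
    (hz : φ z ∈ W n d s t i) : eval z (dehomogenize f) = 0 := by
  rw [eval_dehomogenize, ← eval_rep_φ_eq_zero_iff hf]
  refine ProjSpace.mem_closure_iff.mp hz f hf ?_
  rintro _ ⟨w, hw, rfl⟩
  rw [eval_rep_φ_eq_zero_iff hf, ← eval_dehomogenize]
  exact h w hw

theorem isForm_q (i : Fin (k n d + 1 - n)) : IsForm (q n d s t i) :=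
  ⟨2, ((isHomogeneous_X ℂ _).mul (isHomogeneous_X ℂ _)).sub
    ((isHomogeneous_X ℂ _).mul (isHomogeneous_X ℂ _))⟩

theorem φ_mem_W_iff {i : Fin (k n d + 1 - n)} {z : Fin (k n d) → ℂ} :
    φ z ∈ W n d s t i ↔ z ∈ K n d s t i :=
  ⟨fun hz j hj hji => form_eq_zero_on_W (isForm_q j) (fun _ hw => hw j hj hji) hz, φ_mem_W⟩

theorem affineIdeal_W (hd : 1 ≤ d) (hnk : n ≤ k n d) (hst : IsChoice n d s t)
    (i : Fin (k n d + 1 - n)) : affineIdeal (W n d s t i) =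
      Ideal.span (graphEquations hnk i : Set (MvPolynomial (Fin (k n d)) ℂ)) := by
  apply le_antisymm
  · intro f hf
    rw [mem_affineIdeal] at hf
    simp only [φ_mem_W_iff] at hf
    rw [eval_eq_zero_on_K_iff hd hnk hst] at hf
    simpa [hf] using sub_substParam_mem_span hd hnk i f
  · rw [Ideal.span_le]
    intro f hf
    obtain ⟨r, -, rfl⟩ := Finset.mem_image.mp (Finset.mem_coe.mp hf)
    refine mem_affineIdeal.mpr fun z hz => ?_
    rw [φ_mem_W_iff] at hz
    have h := congrFun (paramPoint_eq_of_mem_K hd hnk hst hz)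
    simp only [paramPoint] at h
    rw [map_sub, h, eval_X, sub_self]

/-- The ideal of `W_i` in the chart `Z_0 ≠ 0` has `i` generators, so Krull's height theorem bounds
its height. -/
theorem irredCodim_W_le (hd : 1 ≤ d) (hst : IsChoice n d s t) (i : Fin (k n d + 1 - n)) :
    irredCodim (W n d s t i) (isIrreducible_W hd hst i) isClosed_closure ≤ (i : ℕ) := by
  have hnk := le_k_of_fin i
  have hmem := φ_mem_W (paramPoint_mem_K hd hnk hst i 0)
  have hprime := isPrime_affineIdeal (isIrreducible_W hd hst i).isPreirreducible hmem
  refine (irredCodim_le_height _ _ hmem).trans ?_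
  refine le_trans (Ideal.height_le_card_of_mem_minimalPrimes_span_finset
    (s := graphEquations hnk i) ?_) (Nat.cast_le.mpr (card_graphEquations_le hnk i))
  rw [← affineIdeal_W hd hnk hst, Ideal.minimalPrimes_eq_subsingleton_self]
  rfl

/-- The sets `W_i` decrease strictly: if `j < i`, the coordinate `Z_{n+i}` is arbitrary on `K_j`,
while on `K_i` it is determined by `Z_1, ..., Z_n`. -/
theorem W_ssubset_W (hd : 1 ≤ d) (hst : IsChoice n d s t) {i j : Fin (k n d + 1 - n)}
    (hji : j < i) : W n d s t i ⊂ W n d s t j := by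
  have hnk := le_k_of_fin i
  have hK : K n d s t i ⊆ K n d s t j := fun z hz r hr hrj => hz r hr (hrj.trans hji.le)
  refine (Set.ssubset_iff_of_subset (closure_mono (Set.image_mono hK))).mpr ?_
  have hi : top n d j < top n d i := top_lt_top_iff.mpr hji
  obtain ⟨r, hr⟩ := Fin.exists_succ_eq.mpr ((Fin.zero_le _).trans_lt hi).ne'
  have hlow : ∀ (c : ℂ) l, (Fin.cons 1 (Pi.single r c : Fin (k n d) → ℂ) : Fin (k n d + 1) → ℂ)
      (low hnk l) = (Fin.cons 1 0 : Fin (k n d + 1) → ℂ) (low hnk l) := by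
    intro c l
    have hl : low hnk l ≠ r.succ := by
      rw [hr]
      intro h
      have h1 : (l : ℕ) = n + i := congrArg Fin.val h
      have := l.isLt
      have : (j : ℕ) < i := hji
      omega
    revert hl
    refine Fin.cases (fun _ => rfl) (fun p hp => ?_) (low hnk l)
    rw [Fin.cons_succ, Fin.cons_succ, Pi.single_eq_of_ne fun h => hp (congrArg Fin.succ h)]
    rfl
  -- the coordinate `Z_{n+i}` is chosen to violate `Z_{n+i} = m_{n+i}(1, 0, ..., 0)`
  set c : ℂ := m n d (top n d i) (fun l => (Fin.cons 1 0 : Fin (k n d + 1) → ℂ) (low hnk l)) + 1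
    with hc
  refine ⟨φ (paramPoint hnk (top n d j) (Pi.single r c)),
    φ_mem_W (paramPoint_mem_K hd hnk hst j _), fun hcon => ?_⟩
  have h := (mem_K_iff hd hnk hst).mp (φ_mem_W_iff.mp hcon) _ le_rfl
  simp only [cons_one_paramPoint_low hd, hlow] at h
  rw [cons_one_paramPoint hd, param_of_not_le hnk hi.not_ge, eval_cons_one_X] at h
  have h2 : (Fin.cons 1 (Pi.single r c : Fin (k n d) → ℂ) : Fin (k n d + 1) → ℂ) (top n d i) =
      c := by
    rw [← hr, Fin.cons_succ, Pi.single_eq_same]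
  rw [h2, hc] at h
  simp at h

theorem le_irredCodim_W (hd : 1 ≤ d) (hst : IsChoice n d s t) (c : ℕ)
    (i : Fin (k n d + 1 - n)) (hi : (i : ℕ) = c) :
    (c : ℕ∞) ≤ irredCodim (W n d s t i) (isIrreducible_W hd hst i) isClosed_closure := by
  induction c generalizing i with
  | zero => simp
  | succ c ih =>
    have hlt : c < k n d + 1 - n := by have := i.isLt; omega
    have hss := W_ssubset_W hd hst (i := i) (j := ⟨c, hlt⟩) (Fin.lt_def.mpr (by simp only; omega))
    rw [Nat.cast_succ]
    exact (add_le_add_left (ih ⟨c, hlt⟩ rfl) 1).trans (Order.coheight_add_one_le hss)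

end Veronese

theorem mainTheorem7 (n d : ℕ) (hn : 1 ≤ n) (hd : 1 ≤ d) :
    (∃ s t, Veronese.IsChoice n d s t) ∧
    ∀ s t, Veronese.IsChoice n d s t → ∀ i : Fin (Veronese.k n d + 1 - n),
      Veronese.V n d i = Veronese.W n d s t i ∧
      ∃ h : IsIrreducible (Veronese.V n d i),
        irredCodim (Veronese.V n d i) h isClosed_closure = ((i : ℕ) : ℕ∞) := by
  refine ⟨Veronese.exists_isChoice hd, fun s t hst i => ?_⟩
  have hVW := Veronese.V_eq_W hd hst i
  have hW := Veronese.isIrreducible_W hd hst i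
  refine ⟨hVW, hVW ▸ hW, ?_⟩
  have h : irredCodim (Veronese.V n d i) (hVW ▸ hW) isClosed_closure =
      irredCodim (Veronese.W n d s t i) hW isClosed_closure :=
    congrArg Order.coheight (TopologicalSpace.IrreducibleCloseds.ext hVW)
  rw [h]
  exact (Veronese.irredCodim_W_le hd hst i).antisymm (Veronese.le_irredCodim_W hd hst i i rfl)

end
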